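/- For a formal Laurent series $G(q)=\sum_n g_n q^n$ with integer coefficients and a positive integer $M$, let $$\mathbf{H}_M\big(G(q)\big):=\sum_{n} g_{Mn}\,q^{Mn},$$ and let $$f(a,b):=\sum_{n\in\mathbb{Z}} a^{n(n+1)/2}\,b^{n(n-1)/2}$$ be Ramanujan's theta series, understood as a formal Laurent series in $q$ when $a=\pm q^{A}$, $b=\pm q^{B}$ with integers $A,B$ such that $A+B>0$. Let $\mu\ge 1$, $\ell\ge 0$ and $m\ge 0$ be integers. (i) If $M=4\ell+2m+3$ and $\sigma=-(3\ell+m+2)k$, then for $(\kappa,\lambda)\in\{(0,1),(1,0)\}$ and any integer $k$ such that $\gcd(k,M)=1$, $$\mathbf{H}_{M}\Big(q^{\sigma}\cdot f\big((-1)^{\kappa}q^{k},(-1)^{\kappa}q^{\mu M-k}\big)^{2\ell+1}\, f\big((-1)^{\lambda}q^{\mu M+k},(-1)^{\lambda}q^{\mu M-k}\big)^{2m+1}\Big)=0.$$ (ii) If $M=2\ell+4m+3$ and $\sigma=-(2\ell+2m+2)k$, then for $(\kappa,\lambda)\in\{(0,1),(1,1)\}$ and any integer $k$ such that $\gcd(k,M)=1$,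 $$\mathbf{H}_{M}\Big(q^{\sigma}\cdot f\big((-1)^{\kappa}q^{k},(-1)^{\kappa}q^{\mu M-k}\big)^{2\ell+1}\, f\big((-1)^{\lambda}q^{\mu M+2k},(-1)^{\lambda}q^{\mu M-2k}\big)^{2m+1}\Big)=0.$$ -/

import Mathlib

noncomputable section

/-- The `n`-th term `a^{n(n+1)/2} b^{n(n-1)/2}` of Ramanujan's theta series. For every integer `n`
both exponents are non-negative integers, so they are taken in `ℕ`. -/
def thetaTerm {R : Type*} [CommRing R] (a b : LaurentSeries R) (n : ℤ) : LaurentSeries R :=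
  a ^ (n * (n + 1) / 2).toNat * b ^ (n * (n - 1) / 2).toNat

/-- The terms `a^{n(n+1)/2} b^{n(n-1)/2}`, `n ∈ ℤ`, can be added up formally: their supports
have a well-ordered union, and each power of `q` occurs in only finitely many of them. -/
def ThetaSummable {R : Type*} [CommRing R] (a b : LaurentSeries R) : Prop :=
  (⋃ n : ℤ, (thetaTerm a b n).support).IsPWO ∧
    ∀ j : ℤ, {n : ℤ | (thetaTerm a b n).coeff j ≠ 0}.Finite

open Classical in
/-- Ramanujan's theta series `f(a,b) = ∑_{n ∈ ℤ} a^{n(n+1)/2} b^{n(n-1)/2}` as a formal sum of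
Laurent series (with the value `0` if the terms cannot be added up formally). -/
def ramanujanTheta {R : Type*} [CommRing R] (a b : LaurentSeries R) : LaurentSeries R :=
  if h : ThetaSummable a b then
    HahnSeries.SummableFamily.hsum
      { toFun := thetaTerm a b
        isPWO_iUnion_support' := h.1
        finite_co_support' := h.2 }
  else 0

/-- The huffing operator `H_M`: it sends `∑ g_n q^n` to `∑ g_{Mn} q^{Mn}`. -/
def huff {R : Type*} [CommRing R] (M : ℕ) (G : LaurentSeries R) : LaurentSeries R where
  coeff n := if (M : ℤ) ∣ n then G.coeff n else 0
  isPWO_support' := G.isPWO_support.mono (by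
    intro n hn
    simp only [Function.mem_support, ne_eq, ite_eq_right_iff, Classical.not_imp] at hn
    exact hn.2)

/-- The power `q^n` of the variable, `n ∈ ℤ`, as a Laurent series with integer coefficients. -/
def qPow (n : ℤ) : LaurentSeries ℤ := HahnSeries.single n 1

theorem qPow_zero : qPow 0 = 1 := rfl

theorem qPow_add (m n : ℤ) : qPow (m + n) = qPow m * qPow n := by
  simp [qPow]

/-- The terms of the theta series at `±q^A`, `±q^B` are signed powers of `q`. -/
theorem thetaTerm_signed (κ : ℕ) (A B n : ℤ) :
    thetaTerm ((-1) ^ κ * qPow A) ((-1) ^ κ * qPow B) n =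
      HahnSeries.single (A * (n * (n + 1) / 2) + B * (n * (n - 1) / 2))
        ((-1 : ℤ) ^ (κ * n.natAbs)) := by
  have hone : ∀ j : ℕ, ((-1 : LaurentSeries ℤ)) ^ j = HahnSeries.single 0 ((-1 : ℤ) ^ j) := by
    intro j
    have h : (-1 : LaurentSeries ℤ) = HahnSeries.single 0 (-1 : ℤ) := by
      rw [HahnSeries.single_neg]; rfl
    rw [h, HahnSeries.single_pow]; simp
  have h1 : 0 ≤ n * (n + 1) / 2 := by
    apply Int.ediv_nonneg _ (by norm_num)
    rcases le_or_gt 0 n with h | h <;> nlinarith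
  have h2 : 0 ≤ n * (n - 1) / 2 := by
    apply Int.ediv_nonneg _ (by norm_num)
    rcases le_or_gt n 0 with h | h <;> nlinarith
  have e1 : n * (n + 1) = n * (n - 1) + n * 2 := by ring
  have e2 : n * (n + 1) / 2 = n * (n - 1) / 2 + n := by
    rw [e1, Int.add_mul_ediv_right _ _ (by norm_num)]
  obtain ⟨s, hs⟩ := Int.eq_ofNat_of_zero_le h1
  obtain ⟨t, ht⟩ := Int.eq_ofNat_of_zero_le h2
  have hst : (s : ℤ) = t + n := by rw [← hs, ← ht, e2]
  have hpar : ((-1 : ℤ) ^ κ) ^ s * ((-1 : ℤ) ^ κ) ^ t = (-1) ^ (κ * n.natAbs) := by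
    rw [← pow_mul, ← pow_mul, ← pow_add, ← mul_add]
    rw [pow_mul, pow_mul]
    rcases neg_one_pow_eq_or ℤ κ with h | h
    · simp [h]
    · rw [h]
      apply neg_one_pow_congr
      rw [Int.natAbs_even, ← Int.even_coe_nat]
      push_cast
      rw [hst]
      constructor
      · rintro ⟨r, hr⟩; exact ⟨r - t, by linarith⟩
      · rintro ⟨r, hr⟩; exact ⟨r + t, by linarith⟩
  unfold thetaTerm
  rw [hs, ht, Int.toNat_natCast, Int.toNat_natCast, hone]
  simp only [qPow, HahnSeries.single_mul_single, HahnSeries.single_pow, zero_add, mul_one, hpar]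
  congr 1
  simp [mul_comm]

/-- The theta series at `±q^A`, `±q^B` is a genuine formal sum as soon as `A + B > 0`. -/
theorem thetaSummable_signed (κ : ℕ) (A B : ℤ) (h : 0 < A + B) :
    ThetaSummable ((-1) ^ κ * qPow A) ((-1) ^ κ * qPow B) := by
  have key : ∀ n j : ℤ,
      (thetaTerm ((-1) ^ κ * qPow A) ((-1) ^ κ * qPow B) n).coeff j ≠ 0 →
        2 * j = (A + B) * n ^ 2 + (A - B) * n := by
    intro n j hj
    rw [thetaTerm_signed] at hj
    have hj' : j = A * (n * (n + 1) / 2) + B * (n * (n - 1) / 2) := by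
      by_contra hne
      exact hj (HahnSeries.coeff_single_of_ne hne)
    have p1 : n * (n + 1) / 2 * 2 = n * (n + 1) :=
      Int.ediv_mul_cancel (Int.even_mul_succ_self n).two_dvd
    have p2 : n * (n - 1) / 2 * 2 = n * (n - 1) :=
      Int.ediv_mul_cancel (Int.even_mul_pred_self n).two_dvd
    rw [hj']
    linear_combination A * p1 + B * p2
  constructor
  · apply Set.IsWF.isPWO
    apply BddBelow.isWF
    refine ⟨-(A - B) ^ 2, ?_⟩
    intro j hj
    obtain ⟨n, hn⟩ := Set.mem_iUnion.1 hj
    have e := key n j hn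
    nlinarith [sq_nonneg (n + (A - B)), sq_nonneg n, sq_nonneg (A - B),
      mul_nonneg (by linarith : 0 ≤ A + B - 1) (sq_nonneg n)]
  · intro j
    apply (Set.finite_Icc (-(2 * |j| + |A - B| + 1)) (2 * |j| + |A - B| + 1)).subset
    intro n hn
    have e := key n j hn
    rw [Set.mem_Icc, ← abs_le]
    by_contra hc
    push Not at hc
    have a1 : (A - B) * n ≥ -(|A - B| * |n|) := by
      rw [← abs_mul]; exact neg_abs_le _
    have a2 : n ^ 2 = |n| ^ 2 := (sq_abs n).symm
    have a3 := le_abs_self j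
    have a4 := abs_nonneg j
    have a5 := abs_nonneg (A - B)
    have a6 : |n| ^ 2 ≤ (A + B) * |n| ^ 2 := by nlinarith [sq_nonneg |n|]
    nlinarith

/-- Coefficients of the theta series at `±q^A`, `±q^B`: the formal sum, with no junk value. -/
theorem coeff_ramanujanTheta_signed (κ : ℕ) (A B : ℤ) (h : 0 < A + B) (j : ℤ) :
    (ramanujanTheta ((-1) ^ κ * qPow A) ((-1) ^ κ * qPow B)).coeff j =
      ∑ᶠ n : ℤ, if j = A * (n * (n + 1) / 2) + B * (n * (n - 1) / 2)
        then (-1 : ℤ) ^ (κ * n.natAbs) else 0 := by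
  unfold ramanujanTheta
  rw [dif_pos (thetaSummable_signed κ A B h), HahnSeries.SummableFamily.coeff_hsum]
  apply finsum_congr
  intro n
  change (thetaTerm ((-1) ^ κ * qPow A) ((-1) ^ κ * qPow B) n).coeff j = _
  rw [thetaTerm_signed]
  split_ifs with hj
  · rw [hj, HahnSeries.coeff_single_same]
  · exact HahnSeries.coeff_single_of_ne hj

end

/-! Expand the product into signed monomials indexed by `(x, y) ∈ ℤ^N₁ × ℤ^N₂`. Modulo `M` the
exponent is `k (w - τ)` with `w = ∑ x + c ∑ y`, so, `k` being a unit, the surviving monomials have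
`w = τ + M t`. Put `r = 2 t + 1`. On each slice of fixed `w`, the reflection `x ↦ d r + 1 - x`, `y ↦
r - y` preserves `w` and the exponent but reverses the sign, so the surviving monomials cancel in
pairs.

The geometry: with `u = x - 1/2`, the quadratic part of the exponent is, up to a constant, `μ M (∑
u² / 2 + ∑ y²)`. As `c d = 2`, the vector `(d, …, d, 1, …, 1)` is normal to the slices for this
form, and the reflection is the central symmetry of a slice about the foot of the perpendicular from
the origin. `IsMonomialSum.huff_eq_zero` does the cancellation; `huff_theta_product_eq_zero` treats
both parts at once. -/

/-- `G` is the formal sum of the monomials `ε i * q ^ e i`, `i ∈ ι`. -/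
def IsMonomialSum {ι : Type} (e ε : ι → ℤ) (G : LaurentSeries ℤ) : Prop :=
  ∃ s : HahnSeries.SummableFamily ℤ ℤ ι,
    (∀ i, s i = HahnSeries.single (e i) (ε i)) ∧ s.hsum = G

theorem isMonomialSum_qPow (n : ℤ) :
    IsMonomialSum (fun _ : Unit => n) (fun _ => 1) (qPow n) :=
  ⟨HahnSeries.SummableFamily.const Unit (qPow n), fun _ => rfl, by
    rw [HahnSeries.SummableFamily.hsum_unique, HahnSeries.SummableFamily.const_toFun]⟩

theorem IsMonomialSum.mul {ι ι' : Type} {e ε : ι → ℤ} {e' ε' : ι' → ℤ} {G G' : LaurentSeries ℤ}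
    (h : IsMonomialSum e ε G) (h' : IsMonomialSum e' ε' G') :
    IsMonomialSum (fun p : ι × ι' => e p.1 + e' p.2) (fun p => ε p.1 * ε' p.2) (G * G') := by
  obtain ⟨s, hs, rfl⟩ := h
  obtain ⟨t, ht, rfl⟩ := h'
  refine ⟨s.mul t, fun p => ?_, HahnSeries.SummableFamily.hsum_mul s t⟩
  rw [HahnSeries.SummableFamily.mul_toFun, hs, ht, HahnSeries.single_mul_single]

theorem IsMonomialSum.congr_equiv {ι ι' : Type} {e ε : ι → ℤ} {e' ε' : ι' → ℤ}
    {G : LaurentSeries ℤ} (h : IsMonomialSum e ε G) (φ : ι ≃ ι')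
    (he : ∀ i, e' (φ i) = e i) (hε : ∀ i, ε' (φ i) = ε i) : IsMonomialSum e' ε' G := by
  obtain ⟨s, hs, rfl⟩ := h
  refine ⟨HahnSeries.SummableFamily.Equiv φ s, fun i => ?_,
    HahnSeries.SummableFamily.hsum_equiv φ s⟩
  rw [HahnSeries.SummableFamily.Equiv_toFun, hs, ← he, ← hε, Equiv.apply_symm_apply]

theorem IsMonomialSum.pow {e ε : ℤ → ℤ} {G : LaurentSeries ℤ} (h : IsMonomialSum e ε G) (N : ℕ) :
    IsMonomialSum (fun x : Fin N → ℤ => ∑ i, e (x i)) (fun x => ∏ i, ε (x i)) (G ^ N) := by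
  induction N with
  | zero =>
    exact (isMonomialSum_qPow 0).congr_equiv (Equiv.ofUnique Unit (Fin 0 → ℤ))
      (fun _ => by simp) (fun _ => by simp)
  | succ N ih =>
    rw [pow_succ']
    refine (h.mul ih).congr_equiv (Fin.consEquiv fun _ => ℤ) (fun p => ?_) (fun p => ?_)
    · simp [Fin.consEquiv, Fin.sum_univ_succ]
    · simp [Fin.consEquiv, Fin.prod_univ_succ]

theorem isMonomialSum_ramanujanTheta (κ : ℕ) (A B : ℤ) (h : 0 < A + B) :
    IsMonomialSum (fun n => A * (n * (n + 1) / 2) + B * (n * (n - 1) / 2))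
      (fun n => (-1) ^ (κ * n.natAbs))
      (ramanujanTheta ((-1) ^ κ * qPow A) ((-1) ^ κ * qPow B)) := by
  unfold ramanujanTheta
  rw [dif_pos (thetaSummable_signed κ A B h)]
  exact ⟨_, fun n => thetaTerm_signed κ A B n, rfl⟩

/-- A sign-reversing involution of the monomials whose exponents are divisible by `M` shows that
the huffing operator kills the series. -/
theorem IsMonomialSum.huff_eq_zero {ι : Type} {e ε : ι → ℤ} {G : LaurentSeries ℤ}
    (h : IsMonomialSum e ε G) (M : ℕ) (φ : ι → ι)
    (hφ : ∀ i, (M : ℤ) ∣ e i → φ (φ i) = i ∧ e (φ i) = e i ∧ ε (φ i) = -ε i) :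
    huff M G = 0 := by
  classical
  obtain ⟨s, hs, rfl⟩ := h
  ext j
  change (if (M : ℤ) ∣ j then s.hsum.coeff j else 0) = 0
  split_ifs with hj
  -- `φ` is controlled only where `M ∣ e i`. Extending by the identity is harmless: the other
  -- monomials contribute nothing at `j`, since `M ∣ j`.
  · let ψ : ι → ι := fun i => if (M : ℤ) ∣ e i then φ i else i
    have hψ : Function.Involutive ψ := by
      intro i
      by_cases hi : (M : ℤ) ∣ e i
      · obtain ⟨h1, h2, -⟩ := hφ i hi
        simp only [ψ, if_pos hi, h2, h1]
      · simp only [ψ, if_neg hi]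
    have hneg : ∀ i, (s (ψ i)).coeff j = -(s i).coeff j := by
      intro i
      rw [hs, hs]
      by_cases hi : (M : ℤ) ∣ e i
      · obtain ⟨-, h2, h3⟩ := hφ i hi
        simp only [ψ, if_pos hi, h2, h3, HahnSeries.single_neg, HahnSeries.coeff_neg]
      · have hne : j ≠ e i := fun hje => hi (hje ▸ hj)
        simp only [ψ, if_neg hi, HahnSeries.coeff_single_of_ne hne, neg_zero]
    rw [HahnSeries.SummableFamily.coeff_hsum]
    have key : ∑ᶠ i, (s i).coeff j = -∑ᶠ i, (s i).coeff j := by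
      rw [← finsum_neg_distrib, ← finsum_comp_equiv hψ.toPerm]
      exact finsum_congr hneg
    linarith
  · rfl

theorem neg_one_pow_mul_natAbs_sub (κ : ℕ) (a n : ℤ) :
    (-1 : ℤ) ^ (κ * (a - n).natAbs) = (-1) ^ (κ * a.natAbs) * (-1) ^ (κ * n.natAbs) := by
  rw [← pow_add, ← mul_add, pow_mul, pow_mul]
  rcases neg_one_pow_eq_or ℤ κ with h | h
  · simp [h]
  · rw [h]
    apply neg_one_pow_congr
    rw [Int.natAbs_even, Nat.even_add, Int.natAbs_even, Int.natAbs_even, Int.even_sub]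

theorem prod_neg_one_pow_mul_natAbs_sub (κ N : ℕ) (hN : Odd N) (a : ℤ) (x : Fin N → ℤ) :
    ∏ i, (-1 : ℤ) ^ (κ * (a - x i).natAbs) =
      (-1) ^ (κ * a.natAbs) * ∏ i, (-1) ^ (κ * (x i).natAbs) := by
  simp only [neg_one_pow_mul_natAbs_sub]
  rw [Finset.prod_mul_distrib, Finset.prod_const, Finset.card_univ, Fintype.card_fin, ← pow_mul,
    mul_comm _ N, pow_mul, hN.neg_one_pow]

theorem sum_const_sub (N : ℕ) (a : ℤ) (x : Fin N → ℤ) :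
    ∑ i, (a - x i) = N * a - ∑ i, x i := by
  simp [Finset.sum_sub_distrib]

theorem sum_quadratic_reflect (N : ℕ) (a c d : ℤ) (x : Fin N → ℤ) :
    ∑ i, (c * (a - x i) ^ 2 + d * (a - x i)) =
      ∑ i, (c * x i ^ 2 + d * x i) + N * (c * a ^ 2 + d * a) - 2 * (c * a + d) * ∑ i, x i := by
  have h : ∀ i, c * (a - x i) ^ 2 + d * (a - x i) =
      (c * x i ^ 2 + d * x i) + (c * a ^ 2 + d * a) - 2 * (c * a + d) * x i := fun i => by ring
  simp only [h, Finset.sum_sub_distrib, Finset.sum_add_distrib, Finset.sum_const,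
    Finset.card_univ, Fintype.card_fin, nsmul_eq_mul, ← Finset.mul_sum]
  ring

/-- Twice the exponent of the `n`-th term of the theta series at `±q^A`, `±q^B`. -/
theorem two_mul_theta_exponent (A B n : ℤ) :
    2 * (A * (n * (n + 1) / 2) + B * (n * (n - 1) / 2)) = (A + B) * n ^ 2 + (A - B) * n := by
  have p1 : n * (n + 1) / 2 * 2 = n * (n + 1) :=
    Int.ediv_mul_cancel (Int.even_mul_succ_self n).two_dvd
  have p2 : n * (n - 1) / 2 * 2 = n * (n - 1) :=
    Int.ediv_mul_cancel (Int.even_mul_pred_self n).two_dvd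
  linear_combination A * p1 + B * p2

theorem two_mul_sum_theta_exponent_reflect (N : ℕ) (A B a : ℤ) (x : Fin N → ℤ) :
    2 * ∑ i, (A * ((a - x i) * (a - x i + 1) / 2) + B * ((a - x i) * (a - x i - 1) / 2)) =
      2 * ∑ i, (A * (x i * (x i + 1) / 2) + B * (x i * (x i - 1) / 2)) +
        N * ((A + B) * a ^ 2 + (A - B) * a) - 2 * ((A + B) * a + (A - B)) * ∑ i, x i := by
  rw [Finset.mul_sum, Finset.mul_sum]
  simp only [two_mul_theta_exponent, sum_quadratic_reflect]

/-- Part (i) is `(c, d) = (1, 2)` and part (ii) is `(2, 1)`. The formulas for `M` and `2 τ` make the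
reflection preserve `w`; `hsign` makes it reverse the sign, because `r` and both `N₁`, `N₂` are odd.
-/
theorem huff_theta_product_eq_zero (μ N₁ N₂ M : ℕ) (k τ c d : ℤ) (κ lam : ℕ) (hμ : 1 ≤ μ)
    (hM0 : 0 < M) (hN₁ : Odd N₁) (hN₂ : Odd N₂) (hcd : c * d = 2) (hM : (M : ℤ) = N₁ * d + N₂ * c)
    (hτ : 2 * τ = M + N₁) (hk : Int.gcd k M = 1) (hsign : Odd (κ * (d + 1) + lam)) :
    huff M (qPow (-τ * k) *
        ramanujanTheta ((-1) ^ κ * qPow k) ((-1) ^ κ * qPow (μ * M - k)) ^ N₁ *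
        ramanujanTheta ((-1) ^ lam * qPow (μ * M + c * k))
          ((-1) ^ lam * qPow (μ * M - c * k)) ^ N₂) = 0 := by
  have hL : (0 : ℤ) < μ * M := by positivity
  have hsum := ((isMonomialSum_qPow (-τ * k)).mul
    ((isMonomialSum_ramanujanTheta κ k (μ * M - k) (by linarith)).pow N₁)).mul
    ((isMonomialSum_ramanujanTheta lam (μ * M + c * k) (μ * M - c * k) (by linarith)).pow N₂)
  let w : (Unit × (Fin N₁ → ℤ)) × (Fin N₂ → ℤ) → ℤ := fun v => ∑ i, v.1.2 i + c * ∑ j, v.2 j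
  -- The division is exact on the surviving monomials, and `r` depends on `w` alone; hence the
  -- reflection, once it fixes `w`, is an involution.
  let r : (Unit × (Fin N₁ → ℤ)) × (Fin N₂ → ℤ) → ℤ := fun v => 2 * ((w v - τ) / M) + 1
  refine hsum.huff_eq_zero M
    (fun v => (((), fun i => d * r v + 1 - v.1.2 i), fun j => r v - v.2 j)) ?_
  rintro ⟨⟨⟨⟩, x⟩, y⟩ hv
  dsimp only at hv ⊢
  have hE₁ : ∀ n : ℤ, k * (n * (n + 1) / 2) + (μ * M - k) * (n * (n - 1) / 2) =
      M * (μ * (n * (n - 1) / 2)) + k * n := fun n => by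
    have e : n * (n + 1) / 2 = n * (n - 1) / 2 + n := by
      rw [← Int.add_mul_ediv_right _ _ (by norm_num)]; ring_nf
    rw [e]; ring
  have hE₂ : ∀ n : ℤ, (μ * M + c * k) * (n * (n + 1) / 2) + (μ * M - c * k) * (n * (n - 1) / 2) =
      M * (μ * n ^ 2) + k * (c * n) := fun n => by
    linarith [two_mul_theta_exponent (μ * M + c * k) (μ * M - c * k) n]
  have hdvd : (M : ℤ) ∣ w (((), x), y) - τ := by
    simp only [hE₁, hE₂, Finset.sum_add_distrib, ← Finset.mul_sum] at hv
    have h1 : (M : ℤ) ∣ k * (w (((), x), y) - τ) := by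
      have := dvd_sub hv (dvd_mul_right (M : ℤ)
        (μ * ∑ i, (x i * (x i - 1) / 2) + μ * ∑ j, y j ^ 2))
      refine this.trans (dvd_of_eq ?_)
      change _ = k * (∑ i, x i + c * ∑ j, y j - τ)
      ring
    exact Int.dvd_of_dvd_mul_right_of_gcd_one h1 (by rw [Int.gcd_comm]; exact hk)
  obtain ⟨t, ht⟩ := hdvd
  have hM0' : (M : ℤ) ≠ 0 := by positivity
  have hr : r (((), x), y) = 2 * t + 1 := by
    simp only [r, ht, Int.mul_ediv_cancel_left _ hM0']
  have hw : w (((), fun i => d * r (((), x), y) + 1 - x i), fun j => r (((), x), y) - y j) =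
      w (((), x), y) := by
    simp only [w] at ht ⊢
    simp only [sum_const_sub, hr]
    -- The reflected value is `N₁ (d r + 1) + c N₂ r - w = M r + N₁ - w`, and `2 w = 2 τ + 2 M t = M
    -- r + N₁`.
    linear_combination (-2) * ht - (2 * t + 1) * hM - hτ
  have hr' : r (((), fun i => d * r (((), x), y) + 1 - x i), fun j => r (((), x), y) - y j) =
      r (((), x), y) := by
    change 2 * ((w _ - τ) / M) + 1 = 2 * ((w _ - τ) / M) + 1
    rw [hw]
  refine ⟨?_, ?_, ?_⟩
  · rw [hr']
    simp
  · simp only [w] at ht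
    have hE : (M : ℤ) * (2 * t + 1) + N₁ - 2 * (∑ i, x i + c * ∑ j, y j) = 0 := by
      linear_combination (-2) * ht - hτ
    have h1 := two_mul_sum_theta_exponent_reflect N₁ k (μ * M - k) (d * (2 * t + 1) + 1) x
    have h2 := two_mul_sum_theta_exponent_reflect N₂ (μ * M + c * k) (μ * M - c * k) (2 * t + 1) y
    rw [hr]
    apply mul_left_cancel₀ (two_ne_zero : (2 : ℤ) ≠ 0)
    -- The quadratic part changes by a multiple of `M r + N₁ - 2 w`, as does the linear part `k w`;
    -- `hE` says that this vanishes, and `hcd` combines the two quadratic forms.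
    linear_combination h1 + h2 + (μ * M * d * (2 * t + 1) + 2 * k) * (hE - (2 * t + 1) * hM)
      - μ * M * (N₂ * (2 * t + 1) ^ 2 - 2 * (2 * t + 1) * ∑ j, y j) * hcd
  · rw [prod_neg_one_pow_mul_natAbs_sub κ N₁ hN₁, prod_neg_one_pow_mul_natAbs_sub lam N₂ hN₂, hr]
    have hs : (-1 : ℤ) ^ (κ * (d * (2 * t + 1) + 1).natAbs) * (-1) ^ (lam * (2 * t + 1).natAbs)
        = -1 := by
      rw [← pow_add]
      apply Odd.neg_one_pow
      rw [← Int.odd_coe_nat]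
      have h2 : (((κ * (d * (2 * t + 1) + 1).natAbs + lam * (2 * t + 1).natAbs : ℕ) : ℤ)) =
        κ * |d * (2 * t + 1) + 1| + lam * |2 * t + 1| := by simp
      rw [h2]
      simp only [Int.odd_add, Int.odd_mul, Int.even_mul, odd_abs, even_abs, Int.even_add] at hsign ⊢
      simp only [← Int.not_even_iff_odd] at hsign ⊢
      simp at hsign ⊢
      tauto
    linear_combination (∏ i, (-1 : ℤ) ^ (κ * (x i).natAbs)) *
      (∏ i, (-1 : ℤ) ^ (lam * (y i).natAbs)) * hs

theorem mainTheorem2 (μ ℓ m : ℕ) (hμ : 1 ≤ μ) :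
    (∀ (M : ℕ) (k σ : ℤ) (κ lam : ℕ),
      M = 4 * ℓ + 2 * m + 3 →
      σ = -(3 * ℓ + m + 2) * k →
      (κ, lam) ∈ ({(0, 1), (1, 0)} : Set (ℕ × ℕ)) →
      Int.gcd k M = 1 →
      huff M (qPow σ *
        ramanujanTheta ((-1) ^ κ * qPow k) ((-1) ^ κ * qPow (μ * M - k)) ^ (2 * ℓ + 1) *
        ramanujanTheta ((-1) ^ lam * qPow (μ * M + k))
          ((-1) ^ lam * qPow (μ * M - k)) ^ (2 * m + 1)) = 0) ∧
    (∀ (M : ℕ) (k σ : ℤ) (κ lam : ℕ),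
      M = 2 * ℓ + 4 * m + 3 →
      σ = -(2 * ℓ + 2 * m + 2) * k →
      (κ, lam) ∈ ({(0, 1), (1, 1)} : Set (ℕ × ℕ)) →
      Int.gcd k M = 1 →
      huff M (qPow σ *
        ramanujanTheta ((-1) ^ κ * qPow k) ((-1) ^ κ * qPow (μ * M - k)) ^ (2 * ℓ + 1) *
        ramanujanTheta ((-1) ^ lam * qPow (μ * M + 2 * k))
          ((-1) ^ lam * qPow (μ * M - 2 * k)) ^ (2 * m + 1)) = 0) := by
  refine ⟨fun M k σ κ lam hM hσ hκ hk => ?_, fun M k σ κ lam hM hσ hκ hk => ?_⟩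
  · have h := huff_theta_product_eq_zero μ (2 * ℓ + 1) (2 * m + 1) M k (3 * ℓ + m + 2) 1 2 κ lam hμ
      (by omega) ⟨ℓ, rfl⟩ ⟨m, rfl⟩ (by norm_num) (by subst hM; push_cast; ring)
      (by subst hM; push_cast; ring) hk (by
        simp only [Set.mem_insert_iff, Set.mem_singleton_iff, Prod.mk.injEq] at hκ
        rcases hκ with ⟨rfl, rfl⟩ | ⟨rfl, rfl⟩ <;> decide)
    rw [one_mul] at h
    rw [hσ]
    exact h
  · rw [hσ]
    exact huff_theta_product_eq_zero μ (2 * ℓ + 1) (2 * m + 1) M k (2 * ℓ + 2 * m + 2) 2 1 κ lam hμ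
      (by omega) ⟨ℓ, rfl⟩ ⟨m, rfl⟩ (by norm_num) (by subst hM; push_cast; ring)
      (by subst hM; push_cast; ring) hk (by
        simp only [Set.mem_insert_iff, Set.mem_singleton_iff, Prod.mk.injEq] at hκ
        rcases hκ with ⟨rfl, rfl⟩ | ⟨rfl, rfl⟩ <;> decide)
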